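/- Theorem (Unimodular Fixed Graphs). Let $G=(V,E)$ be a connected (multi-)graph all of whose vertex degrees are finite. Let $\mathrm{Aut}(G)$ be its automorphism group, with the topology of pointwise convergence on vertices and edges, and let $|\cdot|$ be a left Haar measure on it. Write $\mathrm{Stab}(x)=\{\gamma\in\mathrm{Aut}(G):\gamma x=x\}$ for $x\in V$. Let $\{o_i\}$ be a complete orbit section, i.e., a choice of exactly one vertex from each orbit of $\mathrm{Aut}(G)$ on $V$, and put $$c:=\sum_i |\mathrm{Stab}(o_i)|^{-1}\in(0,\infty].$$ Let $\mathcal G_*$ (resp. $\mathcal G_{**}$) be the space of isomorphism classes $[H,x]$ (resp. $[H,x,y]$) of connected locally finite graphs $H$ with one distinguished vertex (resp. an ordered pair of distinguished vertices), with the Borel $\sigma$-algebra of the local topology (two classes are close if large balls around their distinguished vertices are isomorphic, by an isomorphism that respects the distinguished vertices). A probability measure $\mu$ on $\mathcal G_*$ is called unimodular if for all Borel $f:\mathcal G_{**}\to[0,\infty]$, $$\int\sum_{x\in V(H)}f([H,o,x])\,d\mu([H,o])=\int\sum_{x\in V(H)}f([H,x,o])\,d\mu([H,o]).$$ Then there is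 a random vertex $X$ of $G$ such that the law of $[G,X]$ is unimodular if and only if $\mathrm{Aut}(G)$ is unimodular (its left Haar measure is also right invariant) and $c<\infty$. In this case, there is exactly one unimodular probability measure $\mu$ on $\mathcal G_*$ that is the law of $[G,X]$ for a random vertex $X$ of $G$, and it satisfies $$\mu(\{[G,x]\})=c^{-1}\,|\mathrm{Stab}(x)|^{-1}\qquad\text{for every }x\in V.$$ -/

import Mathlib

open MeasureTheory
open scoped ENNReal Graph

universe u v

/-! Multigraphs are Mathlib's `Graph α β`: a vertex set `V(G)`, an edge set `E(G)` and the incidence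
relation `G.IsLink e x y`; loops and parallel edges are allowed. -/

namespace Graph

/-- An isomorphism of multigraphs: a bijection of the vertices together with a bijection of the
edges that maps the ends of every edge to the ends of its image. -/
@[ext]
structure Iso {α β γ δ : Type*} (G : Graph α β) (H : Graph γ δ) where
  /-- the map on vertices -/
  vert : V(G) ≃ V(H)
  /-- the map on edges -/
  edge : E(G) ≃ E(H)
  isLink_iff : ∀ (e : E(G)) (x y : V(G)), H.IsLink (edge e) (vert x) (vert y) ↔ G.IsLink e x y

namespace Iso

/-- The identity isomorphism. -/
def refl {α β : Type*} (G : Graph α β) : Iso G G :=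
  ⟨Equiv.refl _, Equiv.refl _, fun _ _ _ => Iff.rfl⟩

/-- The inverse isomorphism. -/
def symm {α β γ δ : Type*} {G : Graph α β} {H : Graph γ δ} (φ : Iso G H) : Iso H G :=
  ⟨φ.vert.symm, φ.edge.symm, fun e x y => by
    rw [← φ.isLink_iff]; simp⟩

/-- Composition of isomorphisms, first `φ`, then `ψ`. -/
def trans {α β γ δ ε ζ : Type*} {G : Graph α β} {H : Graph γ δ} {K : Graph ε ζ}
    (φ : Iso G H) (ψ : Iso H K) : Iso G K :=
  ⟨φ.vert.trans ψ.vert, φ.edge.trans ψ.edge, fun e x y => by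
    rw [← φ.isLink_iff, ← ψ.isLink_iff]; rfl⟩

end Iso

/-- The automorphisms of a multigraph. -/
abbrev Aut {α β : Type*} (G : Graph α β) : Type _ := Iso G G

/-- `Aut(G)` is a group under composition. -/
instance {α β : Type*} (G : Graph α β) : Group (Aut G) where
  mul φ ψ := ψ.trans φ
  one := Iso.refl G
  inv φ := φ.symm
  mul_assoc _ _ _ := rfl
  one_mul _ := rfl
  mul_one _ := rfl
  inv_mul_cancel φ := by
    apply Iso.ext
    · exact φ.vert.self_trans_symm
    · exact φ.edge.self_trans_symm

/-- The action of `Aut(G)` on the vertices of `G`. -/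
instance {α β : Type*} (G : Graph α β) : MulAction (Aut G) V(G) where
  smul φ x := φ.vert x
  one_smul _ := rfl
  mul_smul _ _ _ := rfl

/-- The weak topology on `Aut(G)` generated by its action on `G`: the coarsest topology for which
`φ ↦ φ x` and `φ ↦ φ e` are continuous, for all vertices `x` and all edges `e`, where the vertex set
and the edge set are discrete. -/
instance {α β : Type*} (G : Graph α β) : TopologicalSpace (Aut G) :=
  (⨅ x : V(G), TopologicalSpace.induced (fun φ : Aut G => φ.vert x) ⊥) ⊓
    (⨅ e : E(G), TopologicalSpace.induced (fun φ : Aut G => φ.edge e) ⊥)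

/-- `Aut(G)` carries its Borel σ-algebra. -/
instance {α β : Type*} (G : Graph α β) : MeasurableSpace (Aut G) := borel _

instance {α β : Type*} (G : Graph α β) : BorelSpace (Aut G) := ⟨rfl⟩

/-- A (connected, locally finite) graph is unimodular if left Haar measure on `Aut(G)` is also
right invariant. (In Mathlib, `IsHaarMeasure` means left Haar measure.) -/
def IsUnimodular {α β : Type*} (G : Graph α β) : Prop :=
  ∀ m : Measure (Aut G), m.IsHaarMeasure → m.IsMulRightInvariant

/-- `G` is connected (hence nonempty) and all its degrees are finite. -/
structure IsConnectedLocallyFinite {α β : Type*} (G : Graph α β) : Prop where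
  connected : G.toSimpleGraph.Connected
  finite_incidenceSet : ∀ x ∈ V(G), (G.incidenceSet x).Finite

/-- `o` is a complete orbit section: it lists exactly one vertex of each orbit of `Aut(G)`. -/
def IsOrbitSection {α β ι : Type*} (G : Graph α β) (o : ι → V(G)) : Prop :=
  ∀ x : V(G), ∃! i, o i ∈ MulAction.orbit (Aut G) x

end Graph

/-- A connected locally finite graph with an ordered `k`-tuple of distinguished vertices (not
necessarily distinct). Rooted graphs are the case `k = 1`, doubly rooted graphs the case `k = 2`. -/
structure RootedGraph (k : ℕ) : Type (max (u + 1) (v + 1)) where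
  /-- the ambient type of vertices -/
  Vert : Type u
  /-- the ambient type of edges -/
  Edge : Type v
  /-- the underlying graph -/
  graph : Graph Vert Edge
  prop : graph.IsConnectedLocallyFinite
  /-- the distinguished vertices -/
  root : Fin k → V(graph)

namespace RootedGraph

/-- The isomorphisms of the underlying graphs that take the `i`th root to the `i`th root. -/
def IsIso {k : ℕ} (R S : RootedGraph.{u, v} k) : Prop :=
  ∃ φ : Graph.Iso R.graph S.graph, ∀ i, φ.vert (R.root i) = S.root i

/-- Rooted isomorphism is an equivalence relation. -/
instance setoid (k : ℕ) : Setoid (RootedGraph.{u, v} k) where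
  r := IsIso
  iseqv :=
    { refl := fun R => ⟨Graph.Iso.refl R.graph, fun _ => rfl⟩
      symm := fun ⟨φ, h⟩ => ⟨φ.symm, fun i => by
        rw [← h i]; exact φ.vert.symm_apply_apply _⟩
      trans := fun ⟨φ, h⟩ ⟨ψ, h'⟩ => ⟨φ.trans ψ, fun i => by
        rw [← h' i, ← h i]; rfl⟩ }

/-- The vertices at graph distance at most `n` from some root. -/
def ballSet {k : ℕ} (R : RootedGraph.{u, v} k) (n : ℕ) : Set R.Vert :=
  {x | ∃ hx : x ∈ V(R.graph), ∃ i, R.graph.toSimpleGraph.edist (R.root i) ⟨x, hx⟩ ≤ n}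

/-- The ball of radius `n` around the roots, as an induced subgraph. -/
def ball {k : ℕ} (R : RootedGraph.{u, v} k) (n : ℕ) : Graph R.Vert R.Edge :=
  R.graph.induce (R.ballSet n)

theorem root_mem_ball {k : ℕ} (R : RootedGraph.{u, v} k) (n : ℕ) (i : Fin k) :
    (R.root i : R.Vert) ∈ V(R.ball n) :=
  ⟨(R.root i).2, i, by simp⟩

/-- There is a rooted isomorphism of the balls of radius `n` around the roots of `R` and `S`. -/
def AgreeUpTo {k : ℕ} (n : ℕ) (R S : RootedGraph.{u, v} k) : Prop :=
  ∃ φ : Graph.Iso (R.ball n) (S.ball n),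
    ∀ i, φ.vert ⟨R.root i, R.root_mem_ball n i⟩ = ⟨S.root i, S.root_mem_ball n i⟩

end RootedGraph

/-- The space of isomorphism classes of connected locally finite graphs with an ordered `k`-tuple
of distinguished vertices. For `k = 1` this is the space of rooted graphs `𝒢_*`, for `k = 2` it is
the space `𝒢_**` of doubly rooted graphs. -/
def RootedClass (k : ℕ) : Type (max (u + 1) (v + 1)) :=
  Quotient (RootedGraph.setoid.{u, v} k)

namespace RootedClass

/-- The class of the rooted graph `R`. -/
def mk {k : ℕ} (R : RootedGraph.{u, v} k) : RootedClass.{u, v} k := Quotient.mk _ R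

/-- The local topology, generated by the sets of all classes that agree with a given rooted graph in
the ball of radius `n` around the roots. For `k = 1` these sets are the open balls, of radius
`1 / (1 + n)`, of the metric `1 / (1 + α)`, where `α` is the supremum of the `r > 0` such that the
balls of radius `⌊r⌋` around the roots are isomorphic. -/
instance (k : ℕ) : TopologicalSpace (RootedClass.{u, v} k) :=
  TopologicalSpace.generateFrom
    {U | ∃ (R : RootedGraph.{u, v} k) (n : ℕ), U = mk '' {S | R.AgreeUpTo n S}}

/-- Measurable sets and functions are meant with respect to the Borel σ-algebra. -/
instance (k : ℕ) : MeasurableSpace (RootedClass.{u, v} k) := borel _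

instance (k : ℕ) : BorelSpace (RootedClass.{u, v} k) := ⟨rfl⟩

end RootedClass

namespace Graph

/-- The class `[G, x]` in `𝒢_*`. -/
def rootedAt {α : Type u} {β : Type v} (G : Graph α β) (hG : G.IsConnectedLocallyFinite)
    (x : V(G)) : RootedClass.{u, v} 1 :=
  RootedClass.mk ⟨α, β, G, hG, ![x]⟩

/-- The class `[G, x, y]` in `𝒢_**`. -/
def birootedAt {α : Type u} {β : Type v} (G : Graph α β) (hG : G.IsConnectedLocallyFinite)
    (x y : V(G)) : RootedClass.{u, v} 2 :=
  RootedClass.mk ⟨α, β, G, hG, ![x, y]⟩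

/-- `[G, x, y] = [H, φ x, φ y]` for every isomorphism `φ` from `G` to `H`. -/
theorem birootedAt_eq {α γ : Type u} {β δ : Type v} {G : Graph α β} {H : Graph γ δ}
    (hG : G.IsConnectedLocallyFinite) (hH : H.IsConnectedLocallyFinite) (φ : Iso G H)
    (x y : V(G)) : G.birootedAt hG x y = H.birootedAt hH (φ.vert x) (φ.vert y) :=
  Quotient.sound ⟨φ, fun i => by fin_cases i <;> rfl⟩

end Graph

namespace RootedClass

/-- The mass `∑_x f(G, o, x)` sent by the root of `[G, o]`. -/
noncomputable def massOut (f : RootedClass.{u, v} 2 → ℝ≥0∞) : RootedClass.{u, v} 1 → ℝ≥0∞ :=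
  Quotient.lift
    (fun R : RootedGraph.{u, v} 1 => ∑' x : V(R.graph), f (R.graph.birootedAt R.prop (R.root 0) x))
    (by
      rintro R S ⟨φ, h⟩
      rw [← φ.vert.tsum_eq]
      exact tsum_congr fun x => by rw [Graph.birootedAt_eq R.prop S.prop φ, h 0])

/-- The mass `∑_x f(G, x, o)` received by the root of `[G, o]`. -/
noncomputable def massIn (f : RootedClass.{u, v} 2 → ℝ≥0∞) : RootedClass.{u, v} 1 → ℝ≥0∞ :=
  Quotient.lift
    (fun R : RootedGraph.{u, v} 1 => ∑' x : V(R.graph), f (R.graph.birootedAt R.prop x (R.root 0)))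
    (by
      rintro R S ⟨φ, h⟩
      rw [← φ.vert.tsum_eq]
      exact tsum_congr fun x => by rw [Graph.birootedAt_eq R.prop S.prop φ, h 0])

/-- A unimodular measure: a Borel probability measure on `𝒢_*` that obeys the Mass-Transport
Principle. -/
structure IsUnimodularMeasure (μ : Measure (RootedClass.{u, v} 1)) : Prop where
  isProbabilityMeasure : IsProbabilityMeasure μ
  massTransport : ∀ f : RootedClass.{u, v} 2 → ℝ≥0∞, Measurable f →
    ∫⁻ a, massOut f a ∂μ = ∫⁻ a, massIn f a ∂μ

end RootedClass

/-- `μ` is the law of `[G, x]` for a random vertex `x` of `G`, with some distribution `ρ`. -/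
def Graph.IsRandomRooting {α : Type u} {β : Type v} (G : Graph α β)
    (hG : G.IsConnectedLocallyFinite) (μ : Measure (RootedClass.{u, v} 1)) : Prop :=
  ∃ ρ : PMF V(G), μ = (ρ.map (G.rootedAt hG)).toMeasure

/-! Transport mass one from x to y exactly when `[G, x, y] = [G, a, b]`. A root in the orbit of a
sends |Stab(a)b| and a root in the orbit of b receives |Stab(b)a|, so unimodularity of μ gives
μ[G,a]·|Stab(a)b| = μ[G,b]·|Stab(b)a|. Multiplying by the Haar measure of Stab(a) ∩ Stab(b),
orbit-stabilizer shows that μ[G,x]·m(Stab(x)) does not depend on x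
(`measure_singleton_mul_measure_stabilizer`). The masses of the orbits add up to 1, so this constant
is c⁻¹ and c is finite. It also follows that vertices of one orbit have stabilizers of equal
measure, which forces the modular function of Aut(G) to be trivial.

Conversely, root at `o i` with probability proportional to m(Stab(o i))⁻¹. A sum over an orbit is a
normalized Haar integral, and invariance of m under inversion exchanges sent and received mass
(`IsOrbitSection.massTransport`).

Two facts underlie this: stabilizers are compact open, hence of finite positive measure, and
singletons of the rooted spaces are Borel. Both rest on one compactness argument,
`exists_iso_of_ultrafilter`. -/

/-! ### Limits of partial isomorphisms along an ultrafilter. -/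

open Filter in
theorem Ultrafilter.exists_equiv_of_partial {I A B : Type*} (U : Ultrafilter I)
    (P : I → A → B → Prop)
    (hP : ∀ i x y x' y', P i x y → P i x' y' → (x = x' ↔ y = y'))
    (h₁ : ∀ x, ∃ y, ∀ᶠ i in (U : Filter I), P i x y)
    (h₂ : ∀ y, ∃ x, ∀ᶠ i in (U : Filter I), P i x y) :
    ∃ e : A ≃ B, ∀ x, ∀ᶠ i in (U : Filter I), P i x (e x) := by
  choose f hf using h₁
  choose g hg using h₂
  refine ⟨⟨f, g, fun x => ?_, fun y => ?_⟩, hf⟩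
  -- Two eventual relations hold together at some index, and there `P i` is a partial injection.
  · obtain ⟨i, h, h'⟩ := ((hf x).and (hg (f x))).exists
    exact ((hP _ _ _ _ _ h h').2 rfl).symm
  · obtain ⟨i, h, h'⟩ := ((hf (g y)).and (hg y)).exists
    exact (hP _ _ _ _ _ h h').1 rfl

namespace Graph

open Filter

variable {α β γ δ : Type*} {G : Graph α β} {H : Graph γ δ}

theorem IsConnectedLocallyFinite.induction_on (hG : G.IsConnectedLocallyFinite) {p : V(G) → Prop}
    (o : V(G)) (ho : p o)
    (step : ∀ (e : E(G)) (x y : V(G)), G.IsLink e x y → p x → p y) (x : V(G)) : p x := by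
  have h := hG.connected.preconnected o x
  rw [SimpleGraph.reachable_iff_reflTransGen] at h
  induction h with
  | refl => exact ho
  | tail _ hadj ih =>
    obtain ⟨-, e, he⟩ := hadj
    exact step ⟨e, he.edge_mem⟩ _ _ he ih

theorem finite_incident (hG : G.IsConnectedLocallyFinite) (x : V(G)) :
    {e : E(G) | G.Inc e x}.Finite :=
  Set.Finite.preimage (f := fun e : E(G) => (e : β)) (s := G.incidenceSet x)
    Subtype.val_injective.injOn (hG.finite_incidenceSet x x.2)

theorem Inc.exists_isLink {e : E(G)} {x : V(G)} (h : G.Inc e x) : ∃ y : V(G), G.IsLink e x y :=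
  ⟨⟨_, h.isLink_other.right_mem⟩, h.isLink_other⟩

theorem exists_isLink (e : E(G)) : ∃ x y : V(G), G.IsLink e x y :=
  let ⟨_, _, h⟩ := exists_isLink_of_mem_edgeSet e.2
  ⟨⟨_, h.left_mem⟩, ⟨_, h.right_mem⟩, h⟩

/-- Only finitely many edges meet x', so the ultrafilter selects one of them as the image of e. Its
other end is then the image of y. -/
theorem exists_edge_of_ultrafilter (hH : H.IsConnectedLocallyFinite)
    {I : Type*} (U : Ultrafilter I) {P : I → V(G) → V(H) → Prop} {Q : I → E(G) → E(H) → Prop}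
    (hQ : ∀ e, ∀ᶠ i in (U : Filter I), ∃ e', Q i e e')
    (hP : ∀ x, ∀ᶠ i in (U : Filter I), ∃ x', P i x x')
    (link : ∀ i x x' y y' e e', P i x x' → P i y y' → Q i e e' →
      (H.IsLink e' x' y' ↔ G.IsLink e x y))
    {e : E(G)} {x y : V(G)} (he : G.IsLink e x y) {x' : V(H)}
    (hx : ∀ᶠ i in (U : Filter I), P i x x') :
    ∃ e' : E(H), ∃ y' : V(H), (∀ᶠ i in (U : Filter I), Q i e e') ∧
      ∀ᶠ i in (U : Filter I), P i y y' := by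
  have h : ∀ᶠ i in (U : Filter I), ∃ e' ∈ {e : E(H) | H.Inc e x'}, Q i e e' := by
    filter_upwards [hx, hQ e, hP y] with i hi ⟨e', he'⟩ ⟨y', hy'⟩
    exact ⟨e', ((link _ _ _ _ _ _ _ hi hy' he').2 he).inc_left, he'⟩
  obtain ⟨e', hinc, he'⟩ := (Ultrafilter.eventually_exists_mem_iff (finite_incident hH x')).1 h
  obtain ⟨y', hy'⟩ := hinc.exists_isLink
  refine ⟨e', y', he', ?_⟩
  filter_upwards [hx, he', hP y] with i hi hi' ⟨z, hz⟩
  have := (link _ _ _ _ _ _ _ hi hz hi').2 he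
  rwa [Subtype.ext (hy'.right_unique this)]

theorem exists_image_of_ultrafilter (hG : G.IsConnectedLocallyFinite)
    (hH : H.IsConnectedLocallyFinite)
    {I : Type*} (U : Ultrafilter I) {P : I → V(G) → V(H) → Prop} {Q : I → E(G) → E(H) → Prop}
    (hQ : ∀ e, ∀ᶠ i in (U : Filter I), ∃ e', Q i e e')
    (hP : ∀ x, ∀ᶠ i in (U : Filter I), ∃ x', P i x x')
    (link : ∀ i x x' y y' e e', P i x x' → P i y y' → Q i e e' →
      (H.IsLink e' x' y' ↔ G.IsLink e x y))
    {o : V(G)} {o' : V(H)} (ho : ∀ᶠ i in (U : Filter I), P i o o') :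
    (∀ x, ∃ x', ∀ᶠ i in (U : Filter I), P i x x') ∧
      ∀ e, ∃ e', ∀ᶠ i in (U : Filter I), Q i e e' := by
  have hv : ∀ x, ∃ x', ∀ᶠ i in (U : Filter I), P i x x' := fun x =>
    hG.induction_on (p := fun x => ∃ x', ∀ᶠ i in (U : Filter I), P i x x') o ⟨o', ho⟩ (fun e x y he ⟨x', hx'⟩ =>
      let ⟨_, y', _, h⟩ := exists_edge_of_ultrafilter hH U hQ hP link he hx'
      ⟨y', h⟩) x
  refine ⟨hv, fun e => ?_⟩
  obtain ⟨x, y, he⟩ := exists_isLink e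
  obtain ⟨x', hx'⟩ := hv x
  obtain ⟨e', _, h, _⟩ := exists_edge_of_ultrafilter hH U hQ hP link he hx'
  exact ⟨e', h⟩

/-- The limit along an ultrafilter of partial isomorphisms that fix the image of one vertex and are
eventually defined and onto at every vertex and every edge is an isomorphism. -/
theorem exists_iso_of_ultrafilter (hG : G.IsConnectedLocallyFinite)
    (hH : H.IsConnectedLocallyFinite)
    {I : Type*} (U : Ultrafilter I) (P : I → V(G) → V(H) → Prop) (Q : I → E(G) → E(H) → Prop)
    (injP : ∀ i x y x' y', P i x y → P i x' y' → (x = x' ↔ y = y'))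
    (injQ : ∀ i x y x' y', Q i x y → Q i x' y' → (x = x' ↔ y = y'))
    (hP : ∀ x, ∀ᶠ i in (U : Filter I), ∃ x', P i x x')
    (hP' : ∀ x', ∀ᶠ i in (U : Filter I), ∃ x, P i x x')
    (hQ : ∀ e, ∀ᶠ i in (U : Filter I), ∃ e', Q i e e')
    (hQ' : ∀ e', ∀ᶠ i in (U : Filter I), ∃ e, Q i e e')
    (link : ∀ i x x' y y' e e', P i x x' → P i y y' → Q i e e' →
      (H.IsLink e' x' y' ↔ G.IsLink e x y))
    {o : V(G)} {o' : V(H)} (ho : ∀ᶠ i in (U : Filter I), P i o o') :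
    ∃ φ : Iso G H, (∀ x, ∀ᶠ i in (U : Filter I), P i x (φ.vert x)) ∧
      ∀ e, ∀ᶠ i in (U : Filter I), Q i e (φ.edge e) := by
  obtain ⟨hv, he⟩ := exists_image_of_ultrafilter hG hH U hQ hP link ho
  -- The hypotheses are symmetric in G and H; the reversed relations give surjectivity of the limit.
  obtain ⟨hv', he'⟩ := exists_image_of_ultrafilter hH hG U (P := fun i x y => P i y x)
    (Q := fun i x y => Q i y x) hQ' hP'
    (fun i x x' y y' e e' hx hy he => (link i x' x y' y e' e hx hy he).symm) ho
  obtain ⟨f, hf⟩ := U.exists_equiv_of_partial P injP hv hv'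
  obtain ⟨g, hg⟩ := U.exists_equiv_of_partial Q injQ he he'
  refine ⟨⟨f, g, fun e x y => ?_⟩, hf, hg⟩
  obtain ⟨i, ⟨h₁, h₂⟩, h₃⟩ := (((hf x).and (hf y)).and (hg e)).exists
  exact link _ _ _ _ _ _ _ h₁ h₂ h₃

theorem Iso.adj_iff (φ : Iso G H) {x y : V(G)} :
    H.toSimpleGraph.Adj (φ.vert x) (φ.vert y) ↔ G.toSimpleGraph.Adj x y := by
  simp only [toSimpleGraph_adj, ne_eq, EmbeddingLike.apply_eq_iff_eq]
  refine and_congr_right fun _ => ⟨fun ⟨e, he⟩ => ?_, fun ⟨e, he⟩ => ?_⟩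
  · refine ⟨φ.edge.symm ⟨e, he.edge_mem⟩, ?_⟩
    rw [← φ.isLink_iff]
    simpa using he
  · exact ⟨φ.edge ⟨e, he.edge_mem⟩, (φ.isLink_iff ⟨e, he.edge_mem⟩ x y).2 he⟩

theorem Iso.edist_le (φ : Iso G H) (x y : V(G)) :
    H.toSimpleGraph.edist (φ.vert x) (φ.vert y) ≤ G.toSimpleGraph.edist x y := by
  by_cases h : G.toSimpleGraph.Reachable x y
  · obtain ⟨p, hp⟩ := h.exists_walk_length_eq_edist
    let f : G.toSimpleGraph →g H.toSimpleGraph := ⟨φ.vert, fun h => φ.adj_iff.2 h⟩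
    rw [← hp, ← SimpleGraph.Walk.length_map f p]
    exact SimpleGraph.edist_le (p.map f)
  · rw [SimpleGraph.edist_eq_top_of_not_reachable h]
    exact le_top

theorem Iso.edist_eq (φ : Iso G H) (x y : V(G)) :
    H.toSimpleGraph.edist (φ.vert x) (φ.vert y) = G.toSimpleGraph.edist x y := by
  refine (φ.edist_le x y).antisymm ?_
  have := φ.symm.edist_le (φ.vert x) (φ.vert y)
  simpa [Iso.symm] using this

end Graph

/-! ### Balls and the local topology. -/

namespace RootedGraph

variable {k : ℕ} {R S T : RootedGraph.{u, v} k}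

theorem ball_isLink {n : ℕ} {e : R.Edge} {x y : R.Vert} :
    (R.ball n).IsLink e x y ↔ R.graph.IsLink e x y ∧ x ∈ V(R.ball n) ∧ y ∈ V(R.ball n) :=
  Iff.rfl

theorem vertexSet_ball_subset (n : ℕ) : V(R.ball n) ⊆ V(R.graph) := fun _ ⟨h, _⟩ => h

theorem edgeSet_ball_subset (n : ℕ) : E(R.ball n) ⊆ E(R.graph) := fun _ h =>
  let ⟨_, _, h⟩ := Graph.exists_isLink_of_mem_edgeSet h
  (ball_isLink.1 h).1.edge_mem

theorem eventually_mem_ball [NeZero k] (x : V(R.graph)) :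
    ∀ᶠ n in Filter.atTop, (x : R.Vert) ∈ V(R.ball n) := by
  have h := SimpleGraph.edist_ne_top_iff_reachable.2 (R.prop.connected.preconnected (R.root 0) x)
  obtain ⟨m, hm⟩ := ENat.ne_top_iff_exists.1 h
  filter_upwards [Filter.eventually_ge_atTop m] with n hn
  exact ⟨x.2, 0, by rw [← hm]; exact_mod_cast hn⟩

theorem eventually_mem_edgeSet_ball [NeZero k] (e : E(R.graph)) :
    ∀ᶠ n in Filter.atTop, (e : R.Edge) ∈ E(R.ball n) := by
  obtain ⟨x, y, h⟩ := Graph.exists_isLink e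
  filter_upwards [eventually_mem_ball x, eventually_mem_ball y] with n hx hy
  exact (ball_isLink.2 ⟨h, hx, hy⟩).edge_mem

/-- Rooted graphs that agree in all balls are isomorphic. -/
theorem isIso_of_forall_agreeUpTo [NeZero k] (h : ∀ n, R.AgreeUpTo n S) : R.IsIso S := by
  choose φ hφ using h
  have hU : ((Filter.hyperfilter ℕ : Ultrafilter ℕ) : Filter ℕ) ≤ Filter.atTop :=
    Nat.cofinite_eq_atTop ▸ Filter.hyperfilter_le_cofinite
  -- The ball isomorphisms are partial isomorphisms of the whole graphs. Every vertex and edge lies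
  -- in all large balls, and the root 0 anchors the limit.
  obtain ⟨ψ, hψ, -⟩ := Graph.exists_iso_of_ultrafilter R.prop S.prop (Filter.hyperfilter ℕ)
    (fun n x y => ∃ hx : (x : R.Vert) ∈ V(R.ball n), ((φ n).vert ⟨x, hx⟩ : S.Vert) = y)
    (fun n x y => ∃ hx : (x : R.Edge) ∈ E(R.ball n), ((φ n).edge ⟨x, hx⟩ : S.Edge) = y)
    (by
      rintro n x y x' y' ⟨hx, h⟩ ⟨hx', h'⟩
      rw [← Subtype.coe_inj, ← Subtype.coe_inj (a := y), ← h, ← h',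
        Subtype.coe_inj (a := (φ n).vert ⟨x, hx⟩), EmbeddingLike.apply_eq_iff_eq, Subtype.mk.injEq])
    (by
      rintro n x y x' y' ⟨hx, h⟩ ⟨hx', h'⟩
      rw [← Subtype.coe_inj, ← Subtype.coe_inj (a := y), ← h, ← h',
        Subtype.coe_inj (a := (φ n).edge ⟨x, hx⟩), EmbeddingLike.apply_eq_iff_eq, Subtype.mk.injEq])
    (fun x => ((eventually_mem_ball x).filter_mono hU).mono fun n hn =>
      ⟨⟨_, vertexSet_ball_subset n ((φ n).vert ⟨x, hn⟩).2⟩, hn, rfl⟩)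
    (fun y => ((eventually_mem_ball y).filter_mono hU).mono fun n hn =>
      ⟨⟨_, vertexSet_ball_subset n ((φ n).vert.symm ⟨y, hn⟩).2⟩, ((φ n).vert.symm ⟨y, hn⟩).2, by simp⟩)
    (fun x => ((eventually_mem_edgeSet_ball x).filter_mono hU).mono fun n hn =>
      ⟨⟨_, edgeSet_ball_subset n ((φ n).edge ⟨x, hn⟩).2⟩, hn, rfl⟩)
    (fun y => ((eventually_mem_edgeSet_ball y).filter_mono hU).mono fun n hn =>
      ⟨⟨_, edgeSet_ball_subset n ((φ n).edge.symm ⟨y, hn⟩).2⟩, ((φ n).edge.symm ⟨y, hn⟩).2, by simp⟩)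
    (by
      rintro n x x' y y' e e' ⟨hx, h₁⟩ ⟨hy, h₂⟩ ⟨he, h₃⟩
      have := (φ n).isLink_iff ⟨e, he⟩ ⟨x, hx⟩ ⟨y, hy⟩
      have hx' := ((φ n).vert ⟨x, hx⟩).2
      have hy' := ((φ n).vert ⟨y, hy⟩).2
      rw [h₁] at hx'
      rw [h₂] at hy'
      rw [ball_isLink, ball_isLink] at this
      simpa only [hx, hy, hx', hy', and_true, h₁, h₂, h₃] using this)
    (o := R.root 0) (o' := S.root 0)
    (Filter.Eventually.of_forall fun n => ⟨R.root_mem_ball n 0, by rw [hφ]⟩)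
  refine ⟨ψ, fun i => ?_⟩
  obtain ⟨n, _, h⟩ := (hψ (R.root i)).exists
  rw [hφ] at h
  exact (Subtype.ext h).symm

theorem mem_ballSet_iff (φ : Graph.Iso R.graph S.graph) (h : ∀ i, φ.vert (R.root i) = S.root i)
    (n : ℕ) (x : V(R.graph)) : (φ.vert x : S.Vert) ∈ V(S.ball n) ↔ (x : R.Vert) ∈ V(R.ball n) := by
  have key : ∀ i, S.graph.toSimpleGraph.edist (S.root i) (φ.vert x) =
      R.graph.toSimpleGraph.edist (R.root i) x := fun i => by rw [← h, φ.edist_eq]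
  constructor
  · rintro ⟨_, i, hi⟩
    exact ⟨x.2, i, (key i).symm.trans_le hi⟩
  · rintro ⟨_, i, hi⟩
    exact ⟨(φ.vert x).2, i, (key i).trans_le hi⟩

theorem mem_edgeSet_ball_iff (φ : Graph.Iso R.graph S.graph)
    (h : ∀ i, φ.vert (R.root i) = S.root i) (n : ℕ) (e : E(R.graph)) :
    (φ.edge e : S.Edge) ∈ E(S.ball n) ↔ (e : R.Edge) ∈ E(R.ball n) := by
  obtain ⟨x, y, he⟩ := Graph.exists_isLink e
  have he' := (φ.isLink_iff _ _ _).2 he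
  constructor
  · intro hmem
    obtain ⟨a, b, hab⟩ := Graph.exists_isLink_of_mem_edgeSet hmem
    have : (S.ball n).IsLink (φ.edge e) (φ.vert x) (φ.vert y) := by
      rcases (ball_isLink.1 hab).1.eq_and_eq_or_eq_and_eq he' with ⟨rfl, rfl⟩ | ⟨rfl, rfl⟩
      exacts [hab, hab.symm]
    rw [ball_isLink, mem_ballSet_iff φ h, mem_ballSet_iff φ h, φ.isLink_iff] at this
    exact (ball_isLink.2 this).edge_mem
  · intro hmem
    obtain ⟨a, b, hab⟩ := Graph.exists_isLink_of_mem_edgeSet hmem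
    have : (R.ball n).IsLink e x y := by
      rcases (ball_isLink.1 hab).1.eq_and_eq_or_eq_and_eq he with ⟨rfl, rfl⟩ | ⟨rfl, rfl⟩
      exacts [hab, hab.symm]
    rw [ball_isLink, ← mem_ballSet_iff φ h, ← mem_ballSet_iff φ h, ← φ.isLink_iff] at this
    exact (ball_isLink.2 this).edge_mem

theorem IsIso.agreeUpTo (n : ℕ) : R.IsIso S → R.AgreeUpTo n S := by
  rintro ⟨φ, h⟩
  let f : V(R.ball n) ≃ V(S.ball n) :=
    { toFun := fun x => ⟨φ.vert ⟨x, vertexSet_ball_subset n x.2⟩, (mem_ballSet_iff φ h n _).2 x.2⟩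
      invFun := fun y => ⟨φ.vert.symm ⟨y, vertexSet_ball_subset n y.2⟩,
        (mem_ballSet_iff φ h n _).1 (by simp)⟩
      left_inv := fun x => by simp
      right_inv := fun x => by simp }
  let g : E(R.ball n) ≃ E(S.ball n) :=
    { toFun := fun x => ⟨φ.edge ⟨x, edgeSet_ball_subset n x.2⟩,
        (mem_edgeSet_ball_iff φ h n _).2 x.2⟩
      invFun := fun y => ⟨φ.edge.symm ⟨y, edgeSet_ball_subset n y.2⟩,
        (mem_edgeSet_ball_iff φ h n _).1 (by simp)⟩
      left_inv := fun x => by simp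
      right_inv := fun x => by simp }
  refine ⟨⟨f, g, fun e x y => ?_⟩, fun i => ?_⟩
  swap
  · have := congrArg Subtype.val (h i)
    exact Subtype.ext this
  rw [ball_isLink, ball_isLink, ← φ.isLink_iff ⟨e, edgeSet_ball_subset n e.2⟩
    ⟨x, vertexSet_ball_subset n x.2⟩ ⟨y, vertexSet_ball_subset n y.2⟩]
  simp only [Subtype.coe_prop, and_true]
  rfl

theorem AgreeUpTo.trans {n : ℕ} : R.AgreeUpTo n S → S.AgreeUpTo n T → R.AgreeUpTo n T := by
  rintro ⟨φ, h⟩ ⟨ψ, h'⟩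
  exact ⟨φ.trans ψ, fun i => by rw [← h' i, ← h i]; rfl⟩

end RootedGraph

namespace RootedClass

variable {k : ℕ}

theorem mk_eq_mk {R S : RootedGraph.{u, v} k} : mk R = mk S ↔ R.IsIso S := Quotient.eq

/-- The local topology is T₁. -/
instance [NeZero k] : T1Space (RootedClass.{u, v} k) := by
  refine ⟨fun a => ⟨isOpen_iff_forall_mem_open.2 fun b hb => ?_⟩⟩
  obtain ⟨R, rfl⟩ : ∃ R, mk R = a := Quotient.exists_rep a
  obtain ⟨S, rfl⟩ : ∃ S, mk S = b := Quotient.exists_rep b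
  -- A ball that separates S from R gives a basic open set around S that misses R. At least one root
  -- is needed: for k = 0 all balls are empty.
  obtain ⟨n, hn⟩ : ∃ n, ¬ S.AgreeUpTo n R := by
    by_contra! h
    exact hb (mk_eq_mk.2 (RootedGraph.isIso_of_forall_agreeUpTo h))
  refine ⟨mk '' {T | S.AgreeUpTo n T}, ?_, TopologicalSpace.isOpen_generateFrom_of_mem ⟨S, n, rfl⟩,
    S, RootedGraph.IsIso.agreeUpTo n (mk_eq_mk.1 rfl), rfl⟩
  rintro _ ⟨T, hT, rfl⟩ h
  exact hn (RootedGraph.AgreeUpTo.trans hT (RootedGraph.IsIso.agreeUpTo n (mk_eq_mk.1 h)))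

end RootedClass

/-! ### Aut(G) as a second countable, locally compact group. -/

namespace Graph

variable {α β : Type*} {G : Graph α β}

theorem IsConnectedLocallyFinite.countable_vertexSet (hG : G.IsConnectedLocallyFinite) :
    Countable V(G) := by
  obtain ⟨o⟩ := hG.connected.nonempty
  -- `N s` is the set of neighbours of s; its iterates from o are countable and exhaust the
  -- vertices.
  let N : Set V(G) → Set V(G) := fun s =>
    ⋃ x ∈ s, ⋃ e ∈ {e : E(G) | G.Inc e x}, {y : V(G) | G.IsLink e x y}
  have hN : ∀ s, s.Countable → (N s).Countable := fun s hs =>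
    hs.biUnion fun x _ => (finite_incident hG x).countable.biUnion fun e _ =>
      Set.Subsingleton.countable fun y hy z hz => Subtype.ext (IsLink.right_unique hy hz)
  have hc : (⋃ n, N^[n] {o}).Countable := by
    refine Set.countable_iUnion fun n => ?_
    induction n with
    | zero => exact Set.countable_singleton o
    | succ n ih => rw [Function.iterate_succ_apply']; exact hN _ ih
  rw [← Set.countable_univ_iff]
  refine hc.mono fun x _ => ?_
  refine hG.induction_on (p := fun x => x ∈ ⋃ n, N^[n] {o}) o
    (Set.mem_iUnion.2 ⟨0, rfl⟩) (fun e x y he hx => ?_) x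
  obtain ⟨n, hn⟩ := Set.mem_iUnion.1 hx
  refine Set.mem_iUnion.2 ⟨n + 1, ?_⟩
  rw [Function.iterate_succ_apply']
  exact Set.mem_biUnion hn (Set.mem_biUnion (show e ∈ {e : E(G) | G.Inc e x} from he.inc_left) he)

theorem IsConnectedLocallyFinite.countable_edgeSet (hG : G.IsConnectedLocallyFinite) :
    Countable E(G) := by
  have := hG.countable_vertexSet
  rw [← Set.countable_univ_iff]
  refine (Set.countable_iUnion fun x => (finite_incident hG x).countable).mono fun e _ => ?_
  obtain ⟨x, y, h⟩ := exists_isLink e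
  exact Set.mem_iUnion.2 ⟨x, h.inc_left⟩

namespace Aut

@[simp] theorem smul_def (φ : Aut G) (x : V(G)) : φ • x = φ.vert x := rfl

theorem inv_vert (φ : Aut G) : φ⁻¹.vert = φ.vert.symm := rfl

theorem inv_edge (φ : Aut G) : φ⁻¹.edge = φ.edge.symm := rfl

theorem isOpen_setOf_vert_eq (x y : V(G)) : IsOpen {φ : Aut G | φ.vert x = y} := by
  have : @IsOpen _ (TopologicalSpace.induced (fun φ : Aut G => φ.vert x) ⊥)
      {φ : Aut G | φ.vert x = y} := ⟨{y}, trivial, rfl⟩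
  exact (inf_le_left.trans (iInf_le _ x) : (inferInstance : TopologicalSpace (Aut G)) ≤ _) _ this

theorem isOpen_setOf_edge_eq (x y : E(G)) : IsOpen {φ : Aut G | φ.edge x = y} := by
  have : @IsOpen _ (TopologicalSpace.induced (fun φ : Aut G => φ.edge x) ⊥)
      {φ : Aut G | φ.edge x = y} := ⟨{y}, trivial, rfl⟩
  exact (inf_le_right.trans (iInf_le _ x) : (inferInstance : TopologicalSpace (Aut G)) ≤ _) _ this

open Filter Topology

/-- This reduces the topological arguments on Aut(G) to eventual equality at single vertices and
edges. -/
theorem tendsto_nhds_iff {I : Type*} {l : Filter I} {f : I → Aut G} {φ : Aut G} :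
    Tendsto f l (𝓝 φ) ↔ (∀ x, ∀ᶠ i in l, (f i).vert x = φ.vert x) ∧
      ∀ e, ∀ᶠ i in l, (f i).edge e = φ.edge e := by
  constructor
  · intro h
    exact ⟨fun x => h.eventually ((isOpen_setOf_vert_eq x (φ.vert x)).mem_nhds rfl),
      fun x => h.eventually ((isOpen_setOf_edge_eq x (φ.edge x)).mem_nhds rfl)⟩
  · rintro ⟨h₁, h₂⟩
    have : 𝓝 φ = (⨅ x, comap (fun ψ : Aut G => ψ.vert x) (pure (φ.vert x))) ⊓
        ⨅ e, comap (fun ψ : Aut G => ψ.edge e) (pure (φ.edge e)) := by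
      refine (@nhds_inf (Aut G)
        (⨅ x : V(G), TopologicalSpace.induced (fun φ : Aut G => φ.vert x) ⊥)
        (⨅ e : E(G), TopologicalSpace.induced (fun φ : Aut G => φ.edge e) ⊥) φ).trans ?_
      rw [nhds_iInf, nhds_iInf]
      have hv (a : V(G)) : @nhds _ ⊥ a = pure a :=
        congrFun (@nhds_discrete V(G) ⊥ (@DiscreteTopology.mk _ ⊥ rfl)) a
      have he (a : E(G)) : @nhds _ ⊥ a = pure a :=
        congrFun (@nhds_discrete E(G) ⊥ (@DiscreteTopology.mk _ ⊥ rfl)) a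
      simp only [nhds_induced, hv, he]
    rw [this, tendsto_inf, tendsto_iInf, tendsto_iInf]
    simp only [tendsto_comap_iff, tendsto_pure]
    exact ⟨h₁, h₂⟩

instance : IsTopologicalGroup (Aut G) where
  continuous_mul := by
    refine continuous_iff_continuousAt.2 fun ⟨φ, ψ⟩ => ?_
    have h₁ := tendsto_nhds_iff.1 (tendsto_fst (f := 𝓝 φ) (g := 𝓝 ψ))
    have h₂ := tendsto_nhds_iff.1 (tendsto_snd (f := 𝓝 φ) (g := 𝓝 ψ))
    rw [ContinuousAt, nhds_prod_eq]
    refine tendsto_nhds_iff.2 ⟨fun x => ?_, fun e => ?_⟩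
    · filter_upwards [h₂.1 x, h₁.1 (ψ.vert x)] with p hp hp'
      exact (congrArg p.1.vert hp).trans hp'
    · filter_upwards [h₂.2 e, h₁.2 (ψ.edge e)] with p hp hp'
      exact (congrArg p.1.edge hp).trans hp'
  continuous_inv := by
    refine continuous_iff_continuousAt.2 fun φ => ?_
    have h := tendsto_nhds_iff.1 (tendsto_id (x := 𝓝 φ))
    refine tendsto_nhds_iff.2 ⟨fun x => ?_, fun e => ?_⟩
    · filter_upwards [h.1 (φ.vert.symm x)] with ψ hψ
      rw [inv_vert, inv_vert, Equiv.symm_apply_eq]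
      simpa using hψ.symm
    · filter_upwards [h.2 (φ.edge.symm e)] with ψ hψ
      rw [inv_edge, inv_edge, Equiv.symm_apply_eq]
      simpa using hψ.symm

theorem isOpen_stabilizer (x : V(G)) : IsOpen (MulAction.stabilizer (Aut G) x : Set (Aut G)) :=
  isOpen_setOf_vert_eq x x

/-- An ultrafilter of automorphisms fixing o has a pointwise limit, by `exists_iso_of_ultrafilter`
applied to their graphs as relations. -/
theorem isCompact_stabilizer (hG : G.IsConnectedLocallyFinite) (o : V(G)) :
    IsCompact (MulAction.stabilizer (Aut G) o : Set (Aut G)) := by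
  rw [isCompact_iff_ultrafilter_le_nhds]
  intro U hU
  have ho : ∀ᶠ φ : Aut G in (U : Filter (Aut G)), φ.vert o = o := by
    filter_upwards [le_principal_iff.1 hU] with φ hφ using hφ
  obtain ⟨φ, hv, he⟩ := exists_iso_of_ultrafilter hG hG U (fun φ x y => φ.vert x = y)
    (fun φ x y => φ.edge x = y)
    (by rintro φ x _ x' _ rfl rfl; simp) (by rintro φ x _ x' _ rfl rfl; simp)
    (fun x => .of_forall fun φ => ⟨_, rfl⟩)
    (fun x => .of_forall fun φ => ⟨_, φ.vert.apply_symm_apply x⟩)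
    (fun x => .of_forall fun φ => ⟨_, rfl⟩)
    (fun x => .of_forall fun φ => ⟨_, φ.edge.apply_symm_apply x⟩)
    (by rintro φ x _ y _ e _ rfl rfl rfl; exact φ.isLink_iff e x y) ho
  refine ⟨φ, ?_, tendsto_nhds_iff.2 ⟨hv, he⟩⟩
  obtain ⟨ψ, h₁, h₂⟩ := ((hv o).and ho).exists
  exact h₁.symm.trans h₂

theorem locallyCompactSpace (hG : G.IsConnectedLocallyFinite) : LocallyCompactSpace (Aut G) := by
  obtain ⟨o⟩ := hG.connected.nonempty
  exact (isCompact_stabilizer hG o).locallyCompactSpace_of_mem_nhds_of_group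
    ((isOpen_stabilizer o).mem_nhds (one_mem _))

theorem secondCountableTopology (hG : G.IsConnectedLocallyFinite) :
    SecondCountableTopology (Aut G) := by
  have := hG.countable_vertexSet
  have := hG.countable_edgeSet
  let _ : TopologicalSpace V(G) := ⊥
  let _ : TopologicalSpace E(G) := ⊥
  have : DiscreteTopology V(G) := ⟨rfl⟩
  have : DiscreteTopology E(G) := ⟨rfl⟩
  -- Aut(G) carries the topology induced from a countable product of countable discrete spaces.
  have h : Topology.IsInducing
      (fun φ : Aut G => ((fun x => φ.vert x, fun e => φ.edge e) : (V(G) → V(G)) × (E(G) → E(G)))) := by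
    refine Topology.isInducing_iff_nhds.2 fun φ => le_antisymm ?_ ?_
    · rw [← tendsto_iff_comap, nhds_prod_eq, tendsto_prod_iff', tendsto_pi_nhds, tendsto_pi_nhds]
      simp only [nhds_discrete, tendsto_pure]
      exact tendsto_nhds_iff.1 tendsto_id
    · rw [← tendsto_id', tendsto_nhds_iff]
      have := tendsto_comap (f := fun φ : Aut G =>
        ((fun x => φ.vert x, fun e => φ.edge e) : (V(G) → V(G)) × (E(G) → E(G))))
        (x := 𝓝 (fun x => φ.vert x, fun e => φ.edge e))
      rw [nhds_prod_eq, tendsto_prod_iff', tendsto_pi_nhds, tendsto_pi_nhds] at this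
      simpa only [nhds_discrete, tendsto_pure, nhds_prod_eq, id_eq] using this
  exact h.secondCountableTopology

variable (m : Measure (Aut G)) [m.IsHaarMeasure]

theorem measure_stabilizer_ne_zero (x : V(G)) : m (MulAction.stabilizer (Aut G) x) ≠ 0 :=
  ((isOpen_stabilizer x).measure_pos m ⟨1, one_mem _⟩).ne'

theorem measure_stabilizer_ne_top (hG : G.IsConnectedLocallyFinite) (x : V(G)) :
    m (MulAction.stabilizer (Aut G) x) ≠ ∞ :=
  (isCompact_stabilizer hG x).measure_ne_top

end Aut

end Graph

-- The law is a sum of point masses, so f need not be measurable; hence no measurability of `massOut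
-- f` and `massIn f` is required later.
open Classical in
theorem PMF.lintegral_toMeasure_map {A B : Type*} [MeasurableSpace B] [MeasurableSingletonClass B]
    (q : PMF A) (g : A → B) (f : B → ℝ≥0∞) :
    ∫⁻ b, f b ∂(q.map g).toMeasure = ∑' a, q a * f (g a) := by
  have h : (q.map g).toMeasure = Measure.sum fun a => q a • Measure.dirac (g a) := by
    ext s hs
    rw [PMF.toMeasure_apply_eq_tsum, Measure.sum_apply _ hs]
    simp only [Set.indicator_apply, PMF.map_apply, Measure.smul_apply, Measure.dirac_apply' _ hs,
      smul_eq_mul, Pi.one_apply, mul_ite, mul_one, mul_zero]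
    calc ∑' b, (if b ∈ s then ∑' a, if b = g a then q a else 0 else 0)
        = ∑' b, ∑' a, if b = g a then (if g a ∈ s then q a else 0) else 0 := by
          refine tsum_congr fun b => ?_
          by_cases hb : b ∈ s
          · rw [if_pos hb]
            refine tsum_congr fun a => ?_
            by_cases hba : b = g a
            · subst hba; simp [hb]
            · simp [hba]
          · rw [if_neg hb, eq_comm, ENNReal.tsum_eq_zero]
            intro a
            by_cases hba : b = g a
            · subst hba; simp [hb]
            · simp [hba]
      _ = _ := by
          rw [ENNReal.tsum_comm]
          exact tsum_congr fun a => tsum_ite_eq (g a) fun _ => if g a ∈ s then q a else 0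
  rw [h, lintegral_sum_measure]
  simp only [lintegral_smul_measure, lintegral_dirac, smul_eq_mul]

/-! ### Haar measure of stabilizers. -/

namespace Graph.Aut

variable {α β : Type*} {G : Graph α β} (m : Measure (Aut G)) [m.IsHaarMeasure]

open MulAction

theorem measurableSet_setOf_smul_eq (x y : V(G)) : MeasurableSet {g : Aut G | g • x = y} :=
  (isOpen_setOf_vert_eq x y).measurableSet

/-- The set is empty or a left coset of the stabilizer of x. -/
theorem measure_setOf_smul_eq (x y : V(G)) [Decidable (y ∈ orbit (Aut G) x)] :
    m {g : Aut G | g • x = y} =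
      if y ∈ orbit (Aut G) x then m (stabilizer (Aut G) x) else 0 := by
  split_ifs with h
  · obtain ⟨k, rfl⟩ := h
    rw [← measure_preimage_mul m k⁻¹ (stabilizer (Aut G) x)]
    congr 1
    ext g
    simp only [Set.mem_ofPred_eq, Set.mem_preimage, SetLike.mem_coe, mem_stabilizer_iff, mul_smul]
    exact (inv_smul_eq_iff (g := k) (a := g • x) (b := x)).symm
  · have : {g : Aut G | g • x = y} = ∅ :=
      Set.eq_empty_of_forall_notMem fun g hg => h ⟨g, hg⟩
    rw [this, measure_empty]

-- The image of m under g ↦ g • x is m(Stab(x)) times counting measure on the orbit of x.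
open Classical in
theorem lintegral_smul (hG : G.IsConnectedLocallyFinite) (x : V(G)) (h : V(G) → ℝ≥0∞) :
    ∫⁻ g, h (g • x) ∂m =
      m (stabilizer (Aut G) x) * ∑' y, if y ∈ orbit (Aut G) x then h y else 0 := by
  have := hG.countable_vertexSet
  let _ : MeasurableSpace V(G) := ⊤
  have hm : Measurable fun g : Aut G => g • x :=
    measurable_to_countable' fun y => measurableSet_setOf_smul_eq x y
  rw [← lintegral_map (μ := m) (f := h) measurable_from_top hm, lintegral_countable',
    ← ENNReal.tsum_mul_left]
  refine tsum_congr fun y => ?_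
  rw [Measure.map_apply hm (measurableSet_singleton y)]
  change h y * m {g : Aut G | g • x = y} = _
  rw [measure_setOf_smul_eq]
  split_ifs <;> simp [mul_comm]

open Classical in
/-- The orbit-stabilizer relation for Haar measure. -/
theorem measure_stabilizer_eq_tsum (hG : G.IsConnectedLocallyFinite) (a b : V(G)) :
    m (stabilizer (Aut G) a) =
      (∑' y, if ∃ g : Aut G, g • a = a ∧ g • y = b then 1 else 0) *
        m (stabilizer (Aut G) a ∩ stabilizer (Aut G) b : Set (Aut G)) := by
  have := hG.countable_vertexSet
  -- Split Stab(a) according to the image y of b. Each nonempty piece is a left coset of Stab(a) ∩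
  -- Stab(b).
  have hU : (stabilizer (Aut G) a : Set (Aut G)) =
      ⋃ y, ((stabilizer (Aut G) a : Set (Aut G)) ∩ {g | g • b = y}) := by
    ext g
    simp
  conv_lhs => rw [hU]
  rw [measure_iUnion, ← ENNReal.tsum_mul_right]
  · refine tsum_congr fun y => ?_
    split_ifs with h
    · obtain ⟨k, hk, hk'⟩ := h
      rw [one_mul, ← measure_preimage_mul m k
        (stabilizer (Aut G) a ∩ stabilizer (Aut G) b : Set (Aut G))]
      congr 1
      ext g
      simp only [Set.mem_inter_iff, SetLike.mem_coe, mem_stabilizer_iff, Set.mem_ofPred_eq,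
        Set.mem_preimage, mul_smul]
      rw [smul_eq_iff_eq_inv_smul k, smul_eq_iff_eq_inv_smul k, inv_smul_eq_iff.2 hk.symm,
        inv_smul_eq_iff.2 hk'.symm]
    · rw [zero_mul]
      refine (measure_mono_null (fun g hg => ?_) measure_empty)
      exact h ⟨g⁻¹, inv_smul_eq_iff.2 hg.1.symm, inv_smul_eq_iff.2 hg.2.symm⟩
  · exact fun y z hyz => Set.disjoint_left.2 fun g hg hg' => hyz (hg.2.symm.trans hg'.2)
  · exact fun y => (isOpen_stabilizer a).measurableSet.inter (measurableSet_setOf_smul_eq b y)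

/-- Haar measure is right invariant if vertices in the same orbit have stabilizers of the same
measure. -/
theorem isMulRightInvariant_of_measure_stabilizer_smul (hG : G.IsConnectedLocallyFinite)
    (h : ∀ (g : Aut G) (x : V(G)), m (stabilizer (Aut G) (g • x)) = m (stabilizer (Aut G) x)) :
    m.IsMulRightInvariant := by
  have := locallyCompactSpace hG
  have := secondCountableTopology hG
  obtain ⟨o⟩ := hG.connected.nonempty
  refine ⟨fun g => ?_⟩
  -- The right translate is again left invariant, so it is c • m; the compact open stabilizer of o
  -- detects c.
  have hc := Measure.isMulLeftInvariant_eq_smul (m.map (· * g)) m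
  set c := Measure.haarScalarFactor (m.map (· * g)) m
  have h₁ : m (stabilizer (Aut G) o) = c * m (stabilizer (Aut G) o) := by
    have := congrArg (fun ν : Measure (Aut G) => ν (stabilizer (Aut G) o)) hc
    simp only [Measure.map_apply (measurable_mul_const g) (isOpen_stabilizer o).measurableSet,
      Measure.smul_apply] at this
    refine Eq.trans ?_ this
    -- The element g * k fixes g • o if and only if k * g fixes o.
    rw [← h g o, ← measure_preimage_mul m g]
    congr 1
    ext k
    simp [mul_smul, -smul_def]
  have h₂ : (c : ℝ≥0∞) = 1 :=
    ((ENNReal.mul_eq_right (measure_stabilizer_ne_zero m o)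
      (measure_stabilizer_ne_top m hG o)).1 h₁.symm)
  rw [hc, ENNReal.coe_eq_one.1 h₂, one_smul]

/-- Right invariance makes `m.inv` left invariant, hence a multiple of m. The factor is 1 because a
stabilizer is its own inverse. -/
theorem isInvInvariant (hG : G.IsConnectedLocallyFinite) [m.IsMulRightInvariant] :
    m.IsInvInvariant := by
  have := locallyCompactSpace hG
  have := secondCountableTopology hG
  obtain ⟨o⟩ := hG.connected.nonempty
  refine ⟨?_⟩
  have hc := Measure.isMulLeftInvariant_eq_smul m.inv m
  set c := Measure.haarScalarFactor m.inv m
  have h₁ : m (stabilizer (Aut G) o) = c * m (stabilizer (Aut G) o) := by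
    have := congrArg (fun ν : Measure (Aut G) => ν (stabilizer (Aut G) o)) hc
    simp only [Measure.inv_apply, inv_coe_set, Measure.smul_apply] at this
    exact this
  have h₂ : (c : ℝ≥0∞) = 1 :=
    ((ENNReal.mul_eq_right (measure_stabilizer_ne_zero m o)
      (measure_stabilizer_ne_top m hG o)).1 h₁.symm)
  rw [hc, ENNReal.coe_eq_one.1 h₂, one_smul]

end Graph.Aut

/-! ### Mass transport between orbits and the two implications. -/

namespace Graph

open MulAction RootedClass

variable {α : Type u} {β : Type v} {G : Graph α β} (hG : G.IsConnectedLocallyFinite)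

theorem rootedAt_eq_iff {x y : V(G)} :
    G.rootedAt hG x = G.rootedAt hG y ↔ y ∈ orbit (Aut G) x := by
  refine mk_eq_mk.trans ⟨fun ⟨φ, h⟩ => ⟨φ, h 0⟩, fun ⟨φ, h⟩ => ⟨φ, fun i => ?_⟩⟩
  fin_cases i
  exact h

theorem birootedAt_eq_iff {x y a b : V(G)} :
    G.birootedAt hG x y = G.birootedAt hG a b ↔ ∃ g : Aut G, g • x = a ∧ g • y = b := by
  refine mk_eq_mk.trans ⟨fun ⟨φ, h⟩ => ⟨φ, h 0, h 1⟩, fun ⟨φ, h, h'⟩ => ⟨φ, fun i => ?_⟩⟩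
  fin_cases i
  exacts [h, h']

theorem massOut_rootedAt (f : RootedClass.{u, v} 2 → ℝ≥0∞) (x : V(G)) :
    massOut f (G.rootedAt hG x) = ∑' y, f (G.birootedAt hG x y) := rfl

theorem massIn_rootedAt (f : RootedClass.{u, v} 2 → ℝ≥0∞) (x : V(G)) :
    massIn f (G.rootedAt hG x) = ∑' y, f (G.birootedAt hG y x) := rfl

open Classical in
theorem IsOrbitSection.tsum_ite {ι : Type*} {o : ι → V(G)} (ho : G.IsOrbitSection o) (x : V(G))
    (c : ℝ≥0∞) : ∑' i, (if x ∈ orbit (Aut G) (o i) then c else 0) = c := by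
  obtain ⟨i, hi, huniq⟩ := ho x
  rw [tsum_eq_single i fun j hj => if_neg fun h => hj (huniq j (mem_orbit_symm.1 h)),
    if_pos (mem_orbit_symm.1 hi)]

open Classical in
theorem IsOrbitSection.tsum_tsum {ι : Type*} {o : ι → V(G)} (ho : G.IsOrbitSection o)
    (h : V(G) → ℝ≥0∞) :
    ∑' x, h x = ∑' i, ∑' x, if x ∈ orbit (Aut G) (o i) then h x else 0 := by
  rw [ENNReal.tsum_comm]
  exact tsum_congr fun x => (ho.tsum_ite x (h x)).symm

/-- The mass-transport principle for the root `o i` with weight `m(Stab (o i))⁻¹`. -/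
theorem IsOrbitSection.massTransport (hG : G.IsConnectedLocallyFinite)
    {ι : Type*} {o : ι → V(G)} (ho : G.IsOrbitSection o)
    (m : Measure (Aut G)) [m.IsHaarMeasure] [m.IsMulRightInvariant] (F : V(G) → V(G) → ℝ≥0∞)
    (hF : ∀ (g : Aut G) (x y : V(G)), F (g • x) (g • y) = F x y) :
    ∑' i, (m (stabilizer (Aut G) (o i)))⁻¹ * ∑' y, F (o i) y =
      ∑' i, (m (stabilizer (Aut G) (o i)))⁻¹ * ∑' y, F y (o i) := by
  classical
  have := Aut.isInvInvariant m hG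
  -- Orbit sums become Haar integrals, so both sides turn into double sums over pairs of orbits with
  -- symmetric weights.
  have key : ∀ (x : V(G)) (h : V(G) → ℝ≥0∞),
      (∑' y, if y ∈ orbit (Aut G) x then h y else 0) =
        (m (stabilizer (Aut G) x))⁻¹ * ∫⁻ g : Aut G, h (g • x) ∂m := fun x h => by
    rw [Aut.lintegral_smul m hG, ← mul_assoc, ENNReal.inv_mul_cancel
      (Aut.measure_stabilizer_ne_zero m x) (Aut.measure_stabilizer_ne_top m hG x), one_mul]
  simp_rw [ho.tsum_tsum (F (o _)), ho.tsum_tsum (fun y => F y (o _)), key, ← ENNReal.tsum_mul_left]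
  rw [ENNReal.tsum_comm]
  refine tsum_congr fun j => tsum_congr fun i => ?_
  -- Substitute g⁻¹ for g and use the diagonal invariance of F; this is where unimodularity of
  -- Aut(G) enters.
  have hinv : ∫⁻ g : Aut G, F (o i) (g • o j) ∂m = ∫⁻ g : Aut G, F (g • o i) (o j) ∂m := by
    rw [← lintegral_inv_eq_self (μ := m) (fun g => F (g • o i) (o j))]
    refine lintegral_congr fun g => ?_
    rw [← hF g (g⁻¹ • o i), smul_inv_smul]
  rw [hinv, mul_left_comm]

theorem measure_toMeasure_singleton (ρ : PMF V(G)) (x : V(G))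
    [∀ y, Decidable (y ∈ orbit (Aut G) x)] :
    (ρ.map (G.rootedAt hG)).toMeasure {G.rootedAt hG x} =
      ∑' y, if y ∈ orbit (Aut G) x then ρ y else 0 := by
  rw [PMF.toMeasure_apply_singleton _ _ (measurableSet_singleton _), PMF.map_apply]
  refine tsum_congr fun y => ?_
  simp only [rootedAt_eq_iff]

-- Reindexing by k shows that the mass sent or received depends only on the orbit of the root.
open Classical in
theorem tsum_ite_exists_smul (k : Aut G) (x a b : V(G)) :
    (∑' y, if ∃ g : Aut G, g • k • x = a ∧ g • y = b then (1 : ℝ≥0∞) else 0) =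
      ∑' y, if ∃ g : Aut G, g • x = a ∧ g • y = b then 1 else 0 := by
  rw [← (MulAction.toPerm k : Equiv.Perm V(G)).tsum_eq]
  refine tsum_congr fun y => if_congr ⟨?_, ?_⟩ rfl rfl
  · rintro ⟨g, h₁, h₂⟩
    exact ⟨g * k, (mul_smul g k x).trans h₁, (mul_smul g k y).trans h₂⟩
  · rintro ⟨g, h₁, h₂⟩
    refine ⟨g * k⁻¹, ?_, ?_⟩
    · rw [mul_smul, inv_smul_smul, h₁]
    · rw [MulAction.toPerm_apply, mul_smul, inv_smul_smul, h₂]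

/-- A unimodular rooting gives `[G, x]` a mass proportional to the inverse of the measure of the
stabilizer of `x`. -/
theorem measure_singleton_mul_measure_stabilizer {μ : Measure (RootedClass.{u, v} 1)}
    (h : G.IsRandomRooting hG μ) (hμ : IsUnimodularMeasure μ)
    (m : Measure (Aut G)) [m.IsHaarMeasure] (a b : V(G)) :
    μ {G.rootedAt hG a} * m (stabilizer (Aut G) a) =
      μ {G.rootedAt hG b} * m (stabilizer (Aut G) b) := by
  classical
  obtain ⟨ρ, rfl⟩ := h
  have hmt := hμ.massTransport (Set.indicator {G.birootedAt hG a b} 1)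
    (measurable_one.indicator (measurableSet_singleton _))
  simp only [PMF.lintegral_toMeasure_map, massOut_rootedAt, massIn_rootedAt, Set.indicator_apply,
    Set.mem_singleton_iff, Pi.one_apply, birootedAt_eq_iff] at hmt
  -- Both sides acquire the factor m(Stab(a) ∩ Stab(b)); what remains is the mass-transport identity
  -- `hmt`.
  rw [measure_toMeasure_singleton, measure_toMeasure_singleton,
    Aut.measure_stabilizer_eq_tsum m hG a b, Aut.measure_stabilizer_eq_tsum m hG b a,
    Set.inter_comm, ← mul_assoc, ← mul_assoc]
  congr 1
  rw [← ENNReal.tsum_mul_right, ← ENNReal.tsum_mul_right]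
  convert! hmt using 1
  · refine tsum_congr fun x => ?_
    split_ifs with hx
    · obtain ⟨k, rfl⟩ := hx
      exact congrArg (ρ _ * ·) (tsum_ite_exists_smul k a a b).symm
    · rw [zero_mul, eq_comm, mul_eq_zero, ENNReal.tsum_eq_zero]
      exact .inr fun y => if_neg fun ⟨g, hg, _⟩ => hx (mem_orbit_symm.1 ⟨g, hg⟩)
  · refine tsum_congr fun x => ?_
    split_ifs with hx
    · obtain ⟨k, rfl⟩ := hx
      exact congrArg (ρ _ * ·) ((tsum_ite_exists_smul k b b a).symm.trans
        (tsum_congr fun y => if_congr (exists_congr fun g => and_comm) rfl rfl))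
    · rw [zero_mul, eq_comm, mul_eq_zero, ENNReal.tsum_eq_zero]
      exact .inr fun y => if_neg fun ⟨g, _, hg⟩ => hx (mem_orbit_symm.1 ⟨g, hg⟩)

theorem IsOrbitSection.tsum_measure_singleton {ι : Type*} {o : ι → V(G)} (ho : G.IsOrbitSection o)
    {μ : Measure (RootedClass.{u, v} 1)} (h : G.IsRandomRooting hG μ) :
    ∑' i, μ {G.rootedAt hG (o i)} = 1 := by
  classical
  obtain ⟨ρ, rfl⟩ := h
  simp_rw [measure_toMeasure_singleton]
  rw [← ho.tsum_tsum, ρ.tsum_coe]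

/-- With K the common value of μ[G,x]·m(Stab(x)), total mass one reads K·c = 1. This excludes c = ∞,
since K·∞ is 0 or ∞, and gives K = c⁻¹. -/
theorem measure_singleton_eq {ι : Type*} {o : ι → V(G)} (ho : G.IsOrbitSection o)
    {μ : Measure (RootedClass.{u, v} 1)} (h : G.IsRandomRooting hG μ) (hμ : IsUnimodularMeasure μ)
    (m : Measure (Aut G)) [m.IsHaarMeasure] :
    ∑' i, (m (stabilizer (Aut G) (o i)))⁻¹ < ∞ ∧ ∀ x : V(G), μ {G.rootedAt hG x} =
        (∑' i, (m (stabilizer (Aut G) (o i)))⁻¹)⁻¹ * (m (stabilizer (Aut G) x))⁻¹ := by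
  obtain ⟨a⟩ := hG.connected.nonempty
  set K := μ {G.rootedAt hG a} * m (stabilizer (Aut G) a) with hK
  have hx : ∀ x : V(G), μ {G.rootedAt hG x} = K * (m (stabilizer (Aut G) x))⁻¹ := fun x => by
    rw [hK, measure_singleton_mul_measure_stabilizer hG h hμ m a x, mul_assoc,
      ENNReal.mul_inv_cancel (Aut.measure_stabilizer_ne_zero m x)
        (Aut.measure_stabilizer_ne_top m hG x), mul_one]
  have h1 : K * ∑' i, (m (stabilizer (Aut G) (o i)))⁻¹ = 1 := by
    rw [← ENNReal.tsum_mul_left, ← ho.tsum_measure_singleton hG h]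
    exact tsum_congr fun i => (hx _).symm
  have hc : ∑' i, (m (stabilizer (Aut G) (o i)))⁻¹ ≠ ∞ := by
    intro hc
    rw [hc] at h1
    by_cases hK0 : K = 0
    · simp [hK0] at h1
    · simp [ENNReal.mul_top hK0] at h1
  refine ⟨hc.lt_top, fun x => ?_⟩
  rw [hx, ENNReal.eq_inv_of_mul_eq_one_left h1]

theorem IsRandomRooting.isUnimodular {ι : Type*} {o : ι → V(G)} (ho : G.IsOrbitSection o)
    {μ : Measure (RootedClass.{u, v} 1)} (h : G.IsRandomRooting hG μ)
    (hμ : IsUnimodularMeasure μ) : G.IsUnimodular := by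
  intro m _
  refine Aut.isMulRightInvariant_of_measure_stabilizer_smul m hG fun g x => ?_
  obtain ⟨hc, hx⟩ := measure_singleton_eq hG ho h hμ m
  have h1 := ho.tsum_measure_singleton hG h
  have hK0 : (∑' i, (m (stabilizer (Aut G) (o i)))⁻¹)⁻¹ ≠ 0 := ENNReal.inv_ne_zero.2 hc.ne
  have hK1 : (∑' i, (m (stabilizer (Aut G) (o i)))⁻¹)⁻¹ ≠ ∞ := by
    obtain ⟨i, -⟩ := ho x
    rw [ENNReal.inv_ne_top]
    exact ENNReal.summable.tsum_ne_zero_iff.2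
      ⟨i, ENNReal.inv_ne_zero.2 (Aut.measure_stabilizer_ne_top m hG (o i))⟩
  -- Both vertices define the same class, so the mass formula equates the measures of their
  -- stabilizers once c⁻¹ is cancelled.
  have hr : G.rootedAt hG (g • x) = G.rootedAt hG x :=
    (rootedAt_eq_iff hG).2 (mem_orbit_symm.1 (mem_orbit x g))
  have := hx (g • x)
  rw [hr, hx x, ENNReal.mul_right_inj hK0 hK1, inv_inj] at this
  exact this.symm

/-- A random rooting is purely atomic, with all atoms among the classes `[G, x]`. -/
theorem IsRandomRooting.ext {μ ν : Measure (RootedClass.{u, v} 1)} (hμ : G.IsRandomRooting hG μ)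
    (hν : G.IsRandomRooting hG ν) (h : ∀ x, μ {G.rootedAt hG x} = ν {G.rootedAt hG x}) :
    μ = ν := by
  obtain ⟨ρ, rfl⟩ := hμ
  obtain ⟨σ, rfl⟩ := hν
  congr 1
  ext c
  by_cases hc : c ∈ Set.range (G.rootedAt hG)
  · obtain ⟨x, rfl⟩ := hc
    simpa only [PMF.toMeasure_apply_singleton _ _ (measurableSet_singleton _)] using h x
  · have h0 : ∀ τ : PMF V(G), τ.map (G.rootedAt hG) c = 0 := fun τ => by
      rw [PMF.apply_eq_zero_iff, PMF.support_map]
      exact fun ⟨x, _, hx⟩ => hc ⟨x, hx⟩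
    rw [h0, h0]

theorem IsUnimodular.exists_isUnimodularMeasure {ι : Type*} {o : ι → V(G)}
    (hU : G.IsUnimodular) (ho : G.IsOrbitSection o) (m : Measure (Aut G)) [m.IsHaarMeasure]
    (hc : ∑' i, (m (stabilizer (Aut G) (o i)))⁻¹ < ∞) :
    ∃ μ : Measure (RootedClass.{u, v} 1), G.IsRandomRooting hG μ ∧ IsUnimodularMeasure μ := by
  have := hU m inferInstance
  obtain ⟨a⟩ := hG.connected.nonempty
  obtain ⟨i, -⟩ := ho a
  have hc0 : ∑' i, (m (stabilizer (Aut G) (o i)))⁻¹ ≠ 0 := ENNReal.summable.tsum_ne_zero_iff.2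
    ⟨i, ENNReal.inv_ne_zero.2 (Aut.measure_stabilizer_ne_top m hG (o i))⟩
  -- Finiteness of c is exactly what allows these weights to be normalized.
  let q : PMF ι := PMF.normalize (fun i => (m (stabilizer (Aut G) (o i)))⁻¹) hc0 hc.ne
  refine ⟨_, ⟨q.map o, rfl⟩, inferInstance, fun f _ => ?_⟩
  rw [PMF.map_comp, PMF.lintegral_toMeasure_map, PMF.lintegral_toMeasure_map]
  simp only [Function.comp_apply, massOut_rootedAt, massIn_rootedAt, q, PMF.normalize_apply,
    mul_right_comm _ (∑' i, (m (stabilizer (Aut G) (o i)))⁻¹)⁻¹, ENNReal.tsum_mul_right]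
  rw [ho.massTransport hG m (fun x y => f (G.birootedAt hG x y))
    fun g x y => congrArg f ((birootedAt_eq_iff hG).2 ⟨g, rfl, rfl⟩).symm]

end Graph

theorem theoremt {α : Type u} {β : Type v} (G : Graph α β) (hG : G.IsConnectedLocallyFinite)
    {ι : Type*} (o : ι → V(G)) (ho : G.IsOrbitSection o)
    (m : Measure G.Aut) [m.IsHaarMeasure] :
    ((∃ μ : Measure (RootedClass.{u, v} 1), G.IsRandomRooting hG μ ∧ RootedClass.IsUnimodularMeasure μ) ↔
      (G.IsUnimodular ∧ ∑' i, (m (MulAction.stabilizer G.Aut (o i)))⁻¹ < ∞)) ∧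
    ((∃ μ : Measure (RootedClass.{u, v} 1), G.IsRandomRooting hG μ ∧ RootedClass.IsUnimodularMeasure μ) →
      ∃! μ : Measure (RootedClass.{u, v} 1), G.IsRandomRooting hG μ ∧ RootedClass.IsUnimodularMeasure μ) ∧
    (∀ μ : Measure (RootedClass.{u, v} 1), G.IsRandomRooting hG μ → RootedClass.IsUnimodularMeasure μ →
      ∀ x : V(G), μ {G.rootedAt hG x} =
        (∑' i, (m (MulAction.stabilizer G.Aut (o i)))⁻¹)⁻¹ *
          (m (MulAction.stabilizer G.Aut x))⁻¹) := by
  have hiff : (∃ μ, G.IsRandomRooting hG μ ∧ RootedClass.IsUnimodularMeasure μ) ↔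
      (G.IsUnimodular ∧ ∑' i, (m (MulAction.stabilizer G.Aut (o i)))⁻¹ < ∞) :=
    ⟨fun ⟨_, h, hμ⟩ => ⟨h.isUnimodular hG ho hμ, (Graph.measure_singleton_eq hG ho h hμ m).1⟩,
      fun ⟨hU, hc⟩ => hU.exists_isUnimodularMeasure hG ho m hc⟩
  refine ⟨hiff, fun ⟨μ, h, hμ⟩ => ⟨μ, ⟨h, hμ⟩, fun ν ⟨h', hν⟩ => h'.ext hG h fun x => ?_⟩,
    fun μ h hμ => (Graph.measure_singleton_eq hG ho h hμ m).2⟩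
  rw [(Graph.measure_singleton_eq hG ho h hμ m).2, (Graph.measure_singleton_eq hG ho h' hν m).2]
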